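/- \textbf{Setting.} A Turing machine $M=(Q,\Gamma,\delta,q_0,q_{halt})$ has a finite state set $Q$, tape alphabet $\Gamma=\{0,1,\sqcup,\triangleright\}$ and transition function $\delta:Q\times\Gamma\to Q\times\Gamma\times\{L,S,R\}$, such that $\delta(q,\triangleright)=(p,\triangleright,R)$ for some $p$ whenever $q\ne q_{halt}$; $\triangleright$ is never written on a square not containing it; $\delta(q_{halt},a)=(q_{halt},a,S)$ for all $a\in\Gamma$; and no other state behaves in this way. On input $s\in\{0,1\}^*$ the machine starts in state $q_0$, reading square $0$ of the tape $\triangleright\, s\,\sqcup\sqcup\cdots$. Write $M(s)=v$, $v\in\{0,1\}$, if $M$ reaches $q_{halt}$ while reading square $1$, and that square contains $v$. If $M$ halts on all inputs, $t_M(n)$ is the maximal number of steps that $M$ makes on inputs of length $n$. Formulas are first-order formulas in the language $\{=,\in\}$ with one constant symbol $t$ for the table of a computation; $t_{i,j}=t(i)(j)$ is the triple (symbol, state, flag) of square $j$ at step $i$, the flag being $1$ if the square is being read and $0$ otherwise. $\mathbf T_{\langle M,s\rangle}$ is the finite sequence of formulas consisting of first $\mathbf{def}_M$, which does not depend on $s$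 (it says that $t$ is a table of squares $t_{i,j}\in\Gamma\times Q\times\{0,1\}$, that $t_{i,0}$ always carries $\triangleright$, that exactly one square is read at each step, one formula for each value of $\delta$, and that row $0$ is blank exactly from some square on), and then $\mathbf{input}_s$, consisting, in this order, of $\forall j\,(j>\|s\|\to t_{0,j}=(\sqcup,q_0,0))$, $\ t_{0,0}=(\triangleright,q_0,1)$, and $t_{0,j+1}=(s_j,q_0,0)$ for $j=0,\dots,\|s\|-1$. The algorithm $\mathbf{AL}$ decides membership in a finite sequence of formulas by comparing the given formula with the members one after the other. For a finite theory $T$, a proof $\pi=\langle\varphi_0,\dots,\varphi_n\rangle$ of $\varphi_n$ from $T$ in ZFC is a sequence in which each $\varphi_i$ is a logical axiom (a tautology; $\forall x\alpha\to\alpha^x_u$ or $\alpha^x_u\to\exists x\alpha$ with $u$ substitutable for $x$ in $\alpha$; $\forall x(\alpha\to\beta)\to(\forall x\alpha\to\forall x\beta)$; $\alpha\to\forall x\alpha$ with $x$ not free in $\alpha$; $x=x$; or $x=y\to(\alpha\to\beta)$ with $\alpha$ atomic and $\beta$ obtained from $\alpha$ by replacing one occurrence of $x$ by $y$), or an axiom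 of ZFC, or a member of $T$, or satisfies $\varphi_j=(\varphi_k\to\varphi_i)$ for some $j,k<i$, or satisfies $\varphi_i=\forall x_k\varphi_j$ for some $j<i$ and $k\in\omega$. An adjoint check sequence $\langle g_0,\dots,g_n\rangle$ of $\pi$ chooses for each $i$ one of these five reasons (with its indices $j,k$) that applies to $\varphi_i$; the corresponding checkers are $\mathbf G_\Lambda,\mathbf G_{\rm ZFC},\mathbf G_{\rm IN},\mathbf G_{\to},\mathbf G_\forall$. The adjoint checker $\mathbf{CK}_\pi$, on input a theory $\langle U,b\rangle$ (with an algorithm $b$ deciding membership in $U$) and a formula sequence $\sigma$, returns $1$ if $\sigma$ has the length of $\pi$ and every check $g_i$, applied to $\sigma$ and $\langle U,b\rangle$ (where $\mathbf G_{\rm IN}$ uses $b$), succeeds; otherwise it returns $0$. A normal proof of $M(r)=v$ is a proof of $\exists i\; t_{i,1}=(v,q_{halt},1)$ from $\mathbf T_{\langle M,r\rangle}$ in ZFC. \textbf{Lemma (bounded running time).} Let $M$ be a Turing machine, $v\in\{0,1\}$, $r\in\{0,1\}^*$, $M(r)=v$, let $\pi=\langle\varphi_0,\dots,\varphi_n\rangle$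 be a normal proof of $M(r)=v$, and fix an adjoint check sequence $\langle g_0,\dots,g_n\rangle$ of it. Then: (1) There is a Turing machine $\mathbf f$, halting on all inputs, with $\mathbf f(s)=\mathbf{CK}_\pi(\langle\mathbf T_{\langle M,s\rangle},\mathbf{AL}\rangle,\pi)$ for all $s\in\{0,1\}^*$, whose time complexity is bounded: there is a number $K$ with $t_{\mathbf f}(\|s\|)<K$ for all $s\in\{0,1\}^*$. (2) Only the $\mathbf G_{\rm IN}$ checks depend on $s$: for every $i$ such that $g_i$ is not of type $\mathbf G_{\rm IN}$, the check $g_i$ on $(\langle\mathbf T_{\langle M,s\rangle},\mathbf{AL}\rangle,\pi)$ returns $1$ for all $s$. (3) Each $\mathbf G_{\rm IN}$ check looks at a bounded part of $\mathbf T_{\langle M,s\rangle}$: if $g_i$ is of type $\mathbf G_{\rm IN}$, then for all $s$ its value on $(\langle\mathbf T_{\langle M,s\rangle},\mathbf{AL}\rangle,\pi)$ is the answer of $\mathbf{AL}$ for $\varphi_i$ and the sequence of the first $N$ members of $\mathbf T_{\langle M,s\rangle}$ (all of them if there are fewer), where $N$ is the number of members of $\mathbf T_{\langle M,r\rangle}$.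 -/

import Mathlib

namespace NormalProof

/-! ### Formulas of set theory

First-order formulas with named variables `x₀, x₁, …` in the language with `=`, `∈` and one
constant `tbl`, the letter `t` that stands for the table of a Turing machine. All other set
theoretic vocabulary is abbreviation. -/

inductive Trm where
  | var (k : ℕ)
  | tbl
  deriving DecidableEq

inductive Fml where
  | eq (a b : Trm)
  | mem (a b : Trm)
  | neg (φ : Fml)
  | imp (φ ψ : Fml)
  | all (k : ℕ) (φ : Fml)
  deriving DecidableEq

abbrev v (k : ℕ) : Trm := Trm.var k

namespace Fml

def or (φ ψ : Fml) : Fml := imp (neg φ) ψ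
def and (φ ψ : Fml) : Fml := neg (imp φ (neg ψ))
def iff (φ ψ : Fml) : Fml := and (imp φ ψ) (imp ψ φ)
def ex (k : ℕ) (φ : Fml) : Fml := neg (all k (neg φ))
/-- `∀ x_k (x_k ∈ a → φ)` -/
def allIn (k : ℕ) (a : Trm) (φ : Fml) : Fml := all k (imp (mem (v k) a) φ)
/-- `∃ x_k (x_k ∈ a ∧ φ)` -/
def exIn (k : ℕ) (a : Trm) (φ : Fml) : Fml := ex k (and (mem (v k) a) φ)

/-- A false formula, the value of the empty disjunction. -/
def bot : Fml := neg (all 0 (eq (v 0) (v 0)))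
/-- Finite disjunction. -/
def disj : List Fml → Fml
  | [] => bot
  | φ :: l => or φ (disj l)

end Fml

/-- The variable `x_k` occurs in the term. -/
def Trm.Occurs (k : ℕ) (a : Trm) : Prop := a = Trm.var k

/-- The variable `x_k` occurs free in the formula. -/
def Fml.Free (k : ℕ) : Fml → Prop
  | Fml.eq a b => a.Occurs k ∨ b.Occurs k
  | Fml.mem a b => a.Occurs k ∨ b.Occurs k
  | Fml.neg φ => φ.Free k
  | Fml.imp φ ψ => φ.Free k ∨ ψ.Free k
  | Fml.all m φ => k ≠ m ∧ φ.Free k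

def Trm.subst (k : ℕ) (u : Trm) (a : Trm) : Trm := if a = Trm.var k then u else a

/-- `α_u^{x_k}`: the term `u` replaces the free occurrences of `x_k`. -/
def Fml.subst (k : ℕ) (u : Trm) : Fml → Fml
  | Fml.eq a b => Fml.eq (a.subst k u) (b.subst k u)
  | Fml.mem a b => Fml.mem (a.subst k u) (b.subst k u)
  | Fml.neg φ => Fml.neg (φ.subst k u)
  | Fml.imp φ ψ => Fml.imp (φ.subst k u) (ψ.subst k u)
  | Fml.all m φ => if m = k then Fml.all m φ else Fml.all m (φ.subst k u)

/-- The term `u` is substitutable for `x_k` in the formula. -/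
def Fml.Substitutable (k : ℕ) (u : Trm) : Fml → Prop
  | Fml.eq _ _ => True
  | Fml.mem _ _ => True
  | Fml.neg φ => φ.Substitutable k u
  | Fml.imp φ ψ => φ.Substitutable k u ∧ ψ.Substitutable k u
  | Fml.all m φ => ¬ (Fml.all m φ).Free k ∨ (¬ u.Occurs m ∧ φ.Substitutable k u)

/-- Tautologies: true under every valuation of the prime (atomic or universal) formulas. -/
def IsTautology (φ : Fml) : Prop :=
  ∀ val : Fml → Prop,
    (∀ α, val (Fml.neg α) ↔ ¬ val α) →
    (∀ α β, val (Fml.imp α β) ↔ (val α → val β)) → val φ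

/-- Both formulas are atomic and the second one arises from the first one by replacing one
occurrence of the variable `x_k` by the variable `x_m`. -/
inductive ReplaceOne (k m : ℕ) : Fml → Fml → Prop
  | eqLeft (b : Trm) : ReplaceOne k m (Fml.eq (v k) b) (Fml.eq (v m) b)
  | eqRight (a : Trm) : ReplaceOne k m (Fml.eq a (v k)) (Fml.eq a (v m))
  | memLeft (b : Trm) : ReplaceOne k m (Fml.mem (v k) b) (Fml.mem (v m) b)
  | memRight (a : Trm) : ReplaceOne k m (Fml.mem a (v k)) (Fml.mem a (v m))

/-- The set `Λ` of logical postulates, in seven groups. -/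
inductive Logical : Fml → Prop
  | taut (φ : Fml) : IsTautology φ → Logical φ
  | inst (k : ℕ) (u : Trm) (α : Fml) : α.Substitutable k u →
      Logical (Fml.imp (Fml.all k α) (α.subst k u))
  | distrib (k : ℕ) (α β : Fml) :
      Logical (Fml.imp (Fml.all k (Fml.imp α β)) (Fml.imp (Fml.all k α) (Fml.all k β)))
  | vacuous (k : ℕ) (α : Fml) : ¬ α.Free k → Logical (Fml.imp α (Fml.all k α))
  | refl (k : ℕ) : Logical (Fml.eq (v k) (v k))
  | replace (k m : ℕ) (α β : Fml) : ReplaceOne k m α β →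
      Logical (Fml.imp (Fml.eq (v k) (v m)) (Fml.imp α β))
  | exIntro (k : ℕ) (u : Trm) (α : Fml) : α.Substitutable k u →
      Logical (Fml.imp (α.subst k u) (Fml.ex k α))

/-! ### Set theoretic abbreviations

In each abbreviation the number `n` is a level: the bound variables are `x_n, x_{n+1}, …`, so
the abbreviation has its intended meaning when the terms it is applied to only involve variables
of index below `n`. -/

/-- `x = ∅` -/
def isEmpty (n : ℕ) (x : Trm) : Fml := Fml.all n (Fml.neg (Fml.mem (v n) x))

/-- `y = x ∪ {x}` -/
def isSucc (n : ℕ) (x y : Trm) : Fml :=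
  Fml.all n (Fml.iff (Fml.mem (v n) y) (Fml.or (Fml.mem (v n) x) (Fml.eq (v n) x)))

/-- `p = {x, y}` -/
def isUPair (n : ℕ) (x y p : Trm) : Fml :=
  Fml.all n (Fml.iff (Fml.mem (v n) p) (Fml.or (Fml.eq (v n) x) (Fml.eq (v n) y)))

/-- `p = ⟨x, y⟩ = {{x}, {x, y}}` -/
def isPair (n : ℕ) (x y p : Trm) : Fml :=
  Fml.ex n (Fml.ex (n + 1) (Fml.and (isUPair (n + 2) x x (v n))
    (Fml.and (isUPair (n + 2) x y (v (n + 1))) (isUPair (n + 2) (v n) (v (n + 1)) p))))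

/-- `z = (x, y, c) = ⟨⟨x, y⟩, c⟩` -/
def isTriple (n : ℕ) (x y c z : Trm) : Fml :=
  Fml.ex n (Fml.and (isPair (n + 1) x y (v n)) (isPair (n + 1) (v n) c z))

/-- `x` is the natural number `k` -/
def isNum (n : ℕ) : ℕ → Trm → Fml
  | 0, x => isEmpty n x
  | k + 1, x => Fml.ex n (Fml.and (isNum (n + 1) k (v n)) (isSucc (n + 1) (v n) x))

/-- `x` contains `∅` and is closed under `y ↦ y ∪ {y}` -/
def isInductive (n : ℕ) (x : Trm) : Fml :=
  Fml.and (Fml.exIn n x (isEmpty (n + 1) (v n)))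
    (Fml.allIn n x (Fml.exIn (n + 1) x (isSucc (n + 2) (v n) (v (n + 1)))))

/-- `x ∈ ω` -/
def isNat (n : ℕ) (x : Trm) : Fml :=
  Fml.all n (Fml.imp (isInductive (n + 1) (v n)) (Fml.mem x (v n)))

/-- `∀ x_k ∈ ω, φ` -/
def Fml.allNat (k : ℕ) (φ : Fml) : Fml := Fml.all k (Fml.imp (isNat (k + 1) (v k)) φ)
/-- `∃ x_k ∈ ω, φ` -/
def Fml.exNat (k : ℕ) (φ : Fml) : Fml := Fml.ex k (Fml.and (isNat (k + 1) (v k)) φ)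

/-- `⟨x, y⟩ ∈ f` -/
def isApp (n : ℕ) (f x y : Trm) : Fml :=
  Fml.exIn n f (isPair (n + 1) x y (v n))

/-- `f` is a function with domain `ω` all of whose values satisfy `P`. Here `P m y` is the
formula, of level `m`, that says `P` about `y`. -/
def isSeqOf (n : ℕ) (P : ℕ → Trm → Fml) (f : Trm) : Fml :=
  Fml.and
    (Fml.allIn n f (Fml.exNat (n + 1) (Fml.ex (n + 2)
      (Fml.and (isPair (n + 3) (v (n + 1)) (v (n + 2)) (v n)) (P (n + 3) (v (n + 2)))))))
    (Fml.allNat n (Fml.ex (n + 1) (Fml.all (n + 2)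
      (Fml.iff (isApp (n + 3) f (v n) (v (n + 2))) (Fml.eq (v (n + 2)) (v (n + 1)))))))

/-! ### The theory ZFC

Parameters of the two schemes are left free; the universal closures follow by generalization. -/

inductive ZFC : Fml → Prop
  | extensionality : ZFC (Fml.all 0 (Fml.all 1 (Fml.imp
      (Fml.all 2 (Fml.iff (Fml.mem (v 2) (v 0)) (Fml.mem (v 2) (v 1)))) (Fml.eq (v 0) (v 1)))))
  | foundation : ZFC (Fml.all 0 (Fml.imp (Fml.ex 1 (Fml.mem (v 1) (v 0)))
      (Fml.exIn 1 (v 0) (Fml.neg (Fml.exIn 2 (v 0) (Fml.mem (v 2) (v 1)))))))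
  | pairing : ZFC (Fml.all 0 (Fml.all 1 (Fml.ex 2 (isUPair 3 (v 0) (v 1) (v 2)))))
  | union : ZFC (Fml.all 0 (Fml.ex 1 (Fml.all 2
      (Fml.iff (Fml.mem (v 2) (v 1)) (Fml.exIn 3 (v 0) (Fml.mem (v 2) (v 3)))))))
  | powerSet : ZFC (Fml.all 0 (Fml.ex 1 (Fml.all 2
      (Fml.iff (Fml.mem (v 2) (v 1)) (Fml.allIn 3 (v 2) (Fml.mem (v 3) (v 0)))))))
  | infinity : ZFC (Fml.ex 0 (isInductive 1 (v 0)))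
  /-- `∀ z ∃ y ∀ x (x ∈ y ↔ x ∈ z ∧ φ)` -/
  | separation (x y z : ℕ) (φ : Fml) : x ≠ y → x ≠ z → y ≠ z → ¬ φ.Free y →
      ZFC (Fml.all z (Fml.ex y (Fml.all x
        (Fml.iff (Fml.mem (v x) (v y)) (Fml.and (Fml.mem (v x) (v z)) φ)))))
  /-- `∀ a ((∀ x ∈ a) ∃ z ∀ y (φ ↔ y = z) → ∃ b (∀ x ∈ a) (∃ y ∈ b) φ)` -/
  | replacement (x y z a b : ℕ) (φ : Fml) : [x, y, z, a, b].Nodup → ¬ φ.Free z → ¬ φ.Free b →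
      ZFC (Fml.all a (Fml.imp
        (Fml.allIn x (v a) (Fml.ex z (Fml.all y (Fml.iff φ (Fml.eq (v y) (v z))))))
        (Fml.ex b (Fml.allIn x (v a) (Fml.exIn y (v b) φ)))))
  /-- Every set of non-empty pairwise disjoint sets has a set meeting each of them in exactly
  one point. -/
  | choice : ZFC (Fml.all 0 (Fml.imp
      (Fml.and (Fml.allIn 1 (v 0) (Fml.ex 2 (Fml.mem (v 2) (v 1))))
        (Fml.allIn 1 (v 0) (Fml.allIn 2 (v 0) (Fml.imp (Fml.neg (Fml.eq (v 1) (v 2)))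
          (Fml.neg (Fml.exIn 3 (v 1) (Fml.mem (v 3) (v 2))))))))
      (Fml.ex 4 (Fml.allIn 1 (v 0) (Fml.ex 2 (Fml.all 3
        (Fml.iff (Fml.and (Fml.mem (v 3) (v 1)) (Fml.mem (v 3) (v 4)))
          (Fml.eq (v 3) (v 2)))))))))

/-! ### Turing machines -/

/-- The tape alphabet `{0, 1, ⊔, ▷}`. -/
inductive Sym where
  | zero | one | blank | start
  deriving DecidableEq

/-- The moves `L`, `S` (stay) and `R`. -/
inductive Move where
  | left | stay | right
  deriving DecidableEq

def Sym.ofBool (b : Bool) : Sym := if b then Sym.one else Sym.zero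
def Sym.list : List Sym := [Sym.zero, Sym.one, Sym.blank, Sym.start]

structure TM where
  /-- The states are the elements of `Fin card`. -/
  card : ℕ
  δ : Fin card → Sym → Fin card × Sym × Move
  q₀ : Fin card
  qhalt : Fin card
  /-- The left end mark is kept and left to the right, except in the halt state. -/
  start_right : ∀ q, q ≠ qhalt → (δ q Sym.start).2 = (Sym.start, Move.right)
  start_only : ∀ q a, a ≠ Sym.start → (δ q a).2.1 ≠ Sym.start
  halt_stay : ∀ a, δ qhalt a = (qhalt, a, Move.stay)
  halt_unique : ∀ q, (∀ a, δ q a = δ qhalt a) → q = qhalt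

namespace TM

/-- A configuration: state, position of the head, tape contents. -/
structure Config (F : TM) where
  state : Fin F.card
  head : ℕ
  tape : ℕ → Sym

/-- On input `s` the tape is `▷ s ⊔ ⊔ …` and the head is at square `0`. -/
def init (F : TM) (s : List Bool) : F.Config where
  state := F.q₀
  head := 0
  tape := fun j => match j with
    | 0 => Sym.start
    | j + 1 => match s[j]? with
      | some b => Sym.ofBool b
      | none => Sym.blank

def step (F : TM) (c : F.Config) : F.Config where
  state := (F.δ c.state (c.tape c.head)).1
  head := match (F.δ c.state (c.tape c.head)).2.2 with
    | Move.left => c.head - 1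
    | Move.stay => c.head
    | Move.right => c.head + 1
  tape := Function.update c.tape c.head (F.δ c.state (c.tape c.head)).2.1

/-- The configuration after `i` steps on input `s`. -/
def run (F : TM) (s : List Bool) (i : ℕ) : F.Config := F.step^[i] (F.init s)

/-- `F(s) = b`: at some step the machine is in the halt state and reads square `1`, which
contains `b`. -/
def Outputs (F : TM) (s : List Bool) (b : Bool) : Prop :=
  ∃ i, (F.run s i).state = F.qhalt ∧ (F.run s i).head = 1 ∧ (F.run s i).tape 1 = Sym.ofBool b

def HaltsOn (F : TM) (s : List Bool) : Prop := ∃ i, (F.run s i).state = F.qhalt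

/-- The number of steps that the machine uses on input `s`. -/
def steps (F : TM) (s : List Bool) (h : F.HaltsOn s) : ℕ := Nat.find h

/-- The time complexity `t_F(n)`: the maximal number of steps on the inputs of length `n`. -/
def timeComplexity (F : TM) (h : ∀ s, F.HaltsOn s) (n : ℕ) : ℕ :=
  Finset.univ.sup fun w : Fin n → Bool => F.steps (List.ofFn w) (h (List.ofFn w))

end TM

/-! ### The formula sequence describing a machine and its input

A tape square is a triple (symbol, state, flag), where the flag tells whether the square is
being read. Symbols, states and flags are coded by natural numbers. -/

def Sym.code : Sym → ℕ
  | Sym.zero => 0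
  | Sym.one => 1
  | Sym.blank => 2
  | Sym.start => 3

section Squares

variable (M : TM)

/-- `z = (a, q, b)` -/
def isSquare (n : ℕ) (a : Sym) (q : Fin M.card) (b : Bool) (z : Trm) : Fml :=
  Fml.ex n (Fml.ex (n + 1) (Fml.ex (n + 2) (Fml.and (isNum (n + 3) a.code (v n))
    (Fml.and (isNum (n + 3) q.val (v (n + 1))) (Fml.and (isNum (n + 3) b.toNat (v (n + 2)))
      (isTriple (n + 3) (v n) (v (n + 1)) (v (n + 2)) z))))))

/-- `z ∈ A × Q × B` -/
def isSquareIn (A : List Sym) (B : List Bool) (n : ℕ) (z : Trm) : Fml :=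
  Fml.disj (A.flatMap fun a => (List.finRange M.card).flatMap fun q =>
    B.map fun b => isSquare M n a q b z)

/-- `z = t_{i,j}`, that is, `z = t(i)(j)` -/
def isCell (n : ℕ) (i j z : Trm) : Fml :=
  Fml.ex n (Fml.and (isApp (n + 1) Trm.tbl i (v n)) (isApp (n + 1) (v n) j z))

/-- `t_{i,j} ∈ A × Q × B` -/
def cellIn (A : List Sym) (B : List Bool) (n : ℕ) (i j : Trm) : Fml :=
  Fml.ex n (Fml.and (isCell (n + 1) i j (v n)) (isSquareIn M A B (n + 1) (v n)))

/-- `t_{i,j} = (a, q, b)` -/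
def cellEq (n : ℕ) (i j : Trm) (a : Sym) (q : Fin M.card) (b : Bool) : Fml :=
  Fml.ex n (Fml.and (isCell (n + 1) i j (v n)) (isSquare M (n + 1) a q b (v n)))

/-- `t_{i',j} = (π_M(t_{i,j}), p, b)`, where `π_M` is the projection to the symbol -/
def cellCopy (n : ℕ) (i' i j : Trm) (p : Fin M.card) (b : Bool) : Fml :=
  -- `x_n` is the symbol, `x_{n+1}`, `x_{n+2}` the old state and flag, `x_{n+3}` the old square
  Fml.ex n (Fml.and
    (Fml.ex (n + 1) (Fml.ex (n + 2) (Fml.ex (n + 3) (Fml.and (isCell (n + 4) i j (v (n + 3)))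
      (isTriple (n + 4) (v n) (v (n + 1)) (v (n + 2)) (v (n + 3)))))))
    -- `x_{n+1}`, `x_{n+2}` are the new state and flag, `x_{n+3}` is the new square
    (Fml.ex (n + 1) (Fml.ex (n + 2) (Fml.ex (n + 3) (Fml.and (isCell (n + 4) i' j (v (n + 3)))
      (Fml.and (isNum (n + 4) p.val (v (n + 1))) (Fml.and (isNum (n + 4) b.toNat (v (n + 2)))
        (isTriple (n + 4) (v n) (v (n + 1)) (v (n + 2)) (v (n + 3))))))))))

/-- `t_{0,j} = (a, q, b)` -/
def rowZeroEq (n : ℕ) (j : Trm) (a : Sym) (q : Fin M.card) (b : Bool) : Fml :=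
  Fml.ex n (Fml.and (isNum (n + 1) 0 (v n)) (cellEq M (n + 1) (v n) j a q b))

/-- `t ∈ Table_M`: a sequence of sequences of elements of `Γ × Q × {0,1}` -/
def isTable : Fml :=
  isSeqOf 0 (fun n y => isSeqOf n (isSquareIn M Sym.list [false, true]) y) Trm.tbl

/-- `∀ i, t_{i,0} ∈ {▷} × Q × {0,1}` -/
def leftEnd : Fml :=
  Fml.allNat 0 (Fml.ex 1 (Fml.and (isNum 2 0 (v 1))
    (cellIn M [Sym.start] [false, true] 2 (v 0) (v 1))))

/-- `∀ i ∃ k (t_{i,k} ∈ Γ × Q × {1} ∧ ∀ j (j ≠ k → t_{i,j} ∈ Γ × Q × {0}))` -/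
def oneHead : Fml :=
  Fml.allNat 0 (Fml.exNat 1 (Fml.and (cellIn M Sym.list [true] 2 (v 0) (v 1))
    (Fml.allNat 2 (Fml.imp (Fml.neg (Fml.eq (v 2) (v 1)))
      (cellIn M Sym.list [false] 3 (v 0) (v 2))))))

/-- The interpretation of `δ(q, a)`. In it `x_0` is `i`, `x_1` is `j`, `x_2` is `i + 1` and, for
the moves `L` and `R`, `x_3` is `j - 1` and `j + 1` respectively; `x_4` is `k`. -/
def transition (q : Fin M.card) (a : Sym) : Fml :=
  Fml.allNat 0 (Fml.allNat 1 (Fml.imp (cellEq M 2 (v 0) (v 1) a q true)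
    (Fml.ex 2 (Fml.and (isSucc 3 (v 0) (v 2))
      (match M.δ q a with
        | (p, b, Move.left) =>
          Fml.exNat 3 (Fml.and (isSucc 4 (v 3) (v 1))
            (Fml.and (cellEq M 4 (v 2) (v 1) b p false)
              (Fml.and (cellCopy M 4 (v 2) (v 0) (v 3) p true)
                (Fml.allNat 4 (Fml.imp
                  (Fml.and (Fml.neg (Fml.eq (v 4) (v 1))) (Fml.neg (Fml.eq (v 4) (v 3))))
                  (cellCopy M 5 (v 2) (v 0) (v 4) p false))))))
        | (p, b, Move.stay) =>
          Fml.and (cellEq M 4 (v 2) (v 1) b p true)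
            (Fml.allNat 4 (Fml.imp (Fml.neg (Fml.eq (v 4) (v 1)))
              (cellCopy M 5 (v 2) (v 0) (v 4) p false)))
        | (p, b, Move.right) =>
          Fml.exNat 3 (Fml.and (isSucc 4 (v 1) (v 3))
            (Fml.and (cellEq M 4 (v 2) (v 1) b p false)
              (Fml.and (cellCopy M 4 (v 2) (v 0) (v 3) p true)
                (Fml.allNat 4 (Fml.imp
                  (Fml.and (Fml.neg (Fml.eq (v 4) (v 1))) (Fml.neg (Fml.eq (v 4) (v 3))))
                  (cellCopy M 5 (v 2) (v 0) (v 4) p false)))))))))))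

/-- `∃ m (∀ j (j < m → t_{0,j} ≠ (⊔, q₀, 0)) ∧ ∀ j (j ≥ m → t_{0,j} = (⊔, q₀, 0)))` -/
def finiteInput : Fml :=
  Fml.exNat 0 (Fml.and
    (Fml.allNat 1 (Fml.imp (Fml.mem (v 1) (v 0))
      (Fml.neg (rowZeroEq M 2 (v 1) Sym.blank M.q₀ false))))
    (Fml.allNat 1 (Fml.imp (Fml.or (Fml.mem (v 0) (v 1)) (Fml.eq (v 1) (v 0)))
      (rowZeroEq M 2 (v 1) Sym.blank M.q₀ false))))

/-- The formula sequence `def_M`. -/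
def defM : List Fml :=
  [isTable M, leftEnd M, oneHead M] ++
    ((List.finRange M.card).flatMap fun q => Sym.list.map fun a => transition M q a) ++
    [finiteInput M]

/-- `∀ j (j > len → t_{0,j} = (⊔, q₀, 0))` -/
def blanksAfter (len : ℕ) : Fml :=
  Fml.allNat 0 (Fml.imp (Fml.ex 1 (Fml.and (isNum 2 len (v 1)) (Fml.mem (v 1) (v 0))))
    (rowZeroEq M 1 (v 0) Sym.blank M.q₀ false))

/-- `t_{0,j} = (a, q₀, b)` for a given number `j` -/
def inputCell (j : ℕ) (a : Sym) (b : Bool) : Fml :=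
  Fml.ex 0 (Fml.and (isNum 1 j (v 0)) (rowZeroEq M 1 (v 0) a M.q₀ b))

/-- The formula sequence `input_s`. -/
def inputS (s : List Bool) : List Fml :=
  [blanksAfter M s.length, inputCell M 0 Sym.start true] ++
    s.mapIdx fun j b => inputCell M (j + 1) (Sym.ofBool b) false

/-- The formula sequence `T_{⟨M,s⟩}`: first `def_M`, then `input_s`. -/
def theoryMS (s : List Bool) : List Fml := defM M ++ inputS M s

/-- `∃ i, t_{i,1} = (b, q_halt, 1)` -/
def haltsWith (b : Bool) : Fml :=
  Fml.exNat 0 (Fml.ex 1 (Fml.and (isNum 2 1 (v 1))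
    (cellEq M 2 (v 0) (v 1) (Sym.ofBool b) M.qhalt true)))

end Squares

/-! ### Proofs and their checkers -/

/-- A finite theory, given as a formula sequence, with an algorithm deciding membership in it.
(A finite set is always recursive, so no further condition on the algorithm is needed.) -/
structure RTheory where
  T : List Fml
  al : Fml → List Fml → Bool
  correct : ∀ φ, al φ T = true ↔ φ ∈ T

/-- The algorithm `AL`: compare `φ` with the members of the sequence one after the other. -/
def AL (φ : Fml) : List Fml → Bool
  | [] => false
  | ψ :: l => if φ = ψ then true else AL φ l

theorem AL_correct (φ : Fml) (l : List Fml) : AL φ l = true ↔ φ ∈ l := by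
  induction l with
  | nil => simp [AL]
  | cons ψ l ih =>
    by_cases h : φ = ψ
    · simp [AL, h]
    · simp [AL, h, ih]

/-- `⟨T_{⟨M,s⟩}, AL⟩` -/
def theoryAL (M : TM) (s : List Bool) : RTheory where
  T := theoryMS M s
  al := AL
  correct := fun φ => AL_correct φ _

/-- The five types of checkers. -/
inductive Checker where
  /-- `G_Λ` -/
  | logical
  /-- `G_ZFC` -/
  | zfc
  /-- `G_IN` -/
  | member
  /-- `G_→(·, ·, j, k)` -/
  | mp (j k : ℕ)
  /-- `G_∀(·, ·, j, k)` -/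
  | gen (j k : ℕ)

/-- The condition on the `i`-th formula of `π` that goes with a checker. -/
def Checker.Cond (S : RTheory) (π : List Fml) (i : ℕ) : Checker → Prop
  | Checker.logical => ∃ φ, π[i]? = some φ ∧ Logical φ
  | Checker.zfc => ∃ φ, π[i]? = some φ ∧ ZFC φ
  | Checker.member => ∃ φ, π[i]? = some φ ∧ φ ∈ S.T
  | Checker.mp j k => j < i ∧ k < i ∧
      ∃ φ ψ, π[i]? = some φ ∧ π[k]? = some ψ ∧ π[j]? = some (Fml.imp ψ φ)
  | Checker.gen j k => j < i ∧ ∃ ψ, π[j]? = some ψ ∧ π[i]? = some (Fml.all k ψ)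

/-- `S ⊢^π φ`: the sequence `π` ends with `φ`, and each of its members is in `Λ`, or in ZFC, or
in the theory, or follows from earlier ones by modus ponens or by generalization. -/
def Proves (S : RTheory) (π : List Fml) (φ : Fml) : Prop :=
  π.getLast? = some φ ∧ ∀ i < π.length, ∃ g : Checker, g.Cond S π i

/-- `π` is a normal proof of `M(s) = b`. -/
def IsNormalProof (M : TM) (s : List Bool) (b : Bool) (π : List Fml) : Prop :=
  Proves (theoryAL M s) π (haltsWith M b)

open Classical in
/-- The value of a checker at the `i`-th member of `σ`; `G_IN` calls the decision algorithm of
the theory, the other checkers do not use the theory. -/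
noncomputable def Checker.run (g : Checker) (S : RTheory) (σ : List Fml) (i : ℕ) : Bool :=
  match g with
  | Checker.member => match σ[i]? with
    | some φ => S.al φ S.T
    | none => false
  | g => decide (Checker.Cond S σ i g)

/-- `G` is an adjoint check sequence (proof type) of `S ⊢^π φ`: it has the length of `π`, and the
type of each checker is one of the reasons for which the formula is allowed in the proof. -/
def IsCheckSeq (S : RTheory) (π : List Fml) (G : List Checker) : Prop :=
  G.length = π.length ∧ ∀ (i : ℕ) (g : Checker), G[i]? = some g → g.Cond S π i

/-- The adjoint checker of a proof with adjoint check sequence `G`, on input `(S, σ)`: it compares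
the lengths and then runs the checkers of `G` on `σ`. -/
noncomputable def CK (G : List Checker) (S : RTheory) (σ : List Fml) : Bool :=
  if σ.length ≠ G.length then false
  else (G.mapIdx fun i g => g.run S σ i).all id

end NormalProof

/-!
Running `CK_π` on `(⟨T_{M,s}, AL⟩, π)` asks whether the given reasons still justify every member
of `π` when `T_{M,r}` is replaced by `T_{M,s}`. Only the membership checks can change, and they
concern formulas of `T_{M,r}`. Such a formula is in `def_M`, or fixes square `0`, or fixes one of
the first `‖r‖` letters, or says that the input has length `‖r‖`. Hence the answer depends only on
the first `‖r‖ + 1` letters of `s`, and a machine that reads these letters, keeping them in its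
state, computes it in time independent of `s`.
-/

namespace NormalProof

/-! ### Membership in the formula sequence of a machine and an input -/

theorem isNum_injective (n : ℕ) (x : Trm) : Function.Injective fun k => isNum n k x := by
  intro k k' h
  induction k generalizing n x k' with
  | zero =>
    cases k' with
    | zero => rfl
    | succ k' => simp [isNum, isEmpty, Fml.ex] at h
  | succ k ih =>
    cases k' with
    | zero => simp [isNum, isEmpty, Fml.ex] at h
    | succ k' =>
      simp only [isNum, Fml.ex, Fml.and, Fml.neg.injEq, Fml.all.injEq, Fml.imp.injEq] at h
      rw [ih _ _ h.2.1]

theorem isNum_ne_isNat (n k : ℕ) (x y : Trm) : isNum n k x ≠ isNat n y := by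
  cases k <;> simp [isNum, isEmpty, isNat, Fml.ex]

theorem Sym.code_injective : Function.Injective Sym.code := by
  rintro (_ | _) (_ | _) h <;> first | rfl | cases h

theorem Sym.ofBool_injective : Function.Injective Sym.ofBool := by decide

theorem Sym.ofBool_ne_start (b : Bool) : Sym.ofBool b ≠ Sym.start := by
  cases b <;> decide

section Membership

variable {M : TM}

theorem isSquare_symbol_injective (n : ℕ) (q : Fin M.card) (b : Bool) (z : Trm) :
    Function.Injective fun a => isSquare M n a q b z := by
  intro a a' h
  simp only [isSquare, Fml.ex, Fml.and, Fml.neg.injEq, Fml.all.injEq, Fml.imp.injEq] at h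
  exact Sym.code_injective (isNum_injective _ _ h.2.2.2.1)

theorem index_eq_of_inputCell_eq {j j' : ℕ} {a a' : Sym} {b b' : Bool}
    (h : inputCell M j a b = inputCell M j' a' b') : j = j' := by
  simp only [inputCell, Fml.ex, Fml.and, Fml.neg.injEq, Fml.all.injEq, Fml.imp.injEq] at h
  exact isNum_injective _ _ h.2.1

theorem inputCell_symbol_injective (j : ℕ) (b : Bool) :
    Function.Injective fun a => inputCell M j a b := by
  intro a a' h
  simp only [inputCell, rowZeroEq, cellEq, Fml.ex, Fml.and, Fml.neg.injEq, Fml.all.injEq,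
    Fml.imp.injEq] at h
  exact isSquare_symbol_injective _ _ _ _ h.2.2.2.2.2.2

theorem blanksAfter_injective : Function.Injective (blanksAfter M) := by
  intro k k' h
  simp only [blanksAfter, Fml.allNat, Fml.ex, Fml.and, Fml.neg.injEq, Fml.all.injEq,
    Fml.imp.injEq] at h
  exact isNum_injective _ _ h.2.2.1.2.1

theorem blanksAfter_ne_inputCell (k j : ℕ) (a : Sym) (b : Bool) :
    blanksAfter M k ≠ inputCell M j a b := by
  simp [blanksAfter, inputCell, Fml.allNat, Fml.ex]

-- Every formula of `def_M` differs from `blanksAfter` and `inputCell` in its leading connectives.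
theorem blanksAfter_notMem_defM (k : ℕ) : blanksAfter M k ∉ defM M := by
  simp [defM, blanksAfter, isTable, isSeqOf, leftEnd, oneHead, transition, finiteInput,
    Fml.allNat, Fml.exNat, Fml.and, Fml.ex]

theorem inputCell_notMem_defM (j : ℕ) (a : Sym) (b : Bool) : inputCell M j a b ∉ defM M := by
  simp [defM, inputCell, isTable, isSeqOf, leftEnd, oneHead, transition, finiteInput,
    Fml.allNat, Fml.exNat, Fml.and, Fml.ex, isNum_ne_isNat]

variable (M) in
/-- The part of `input_s` that depends on the letters of `s`: the formulas
`t_{0,j+1} = (s_j, q₀, 0)` for `j < ‖s‖`. -/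
def letterCells (s : List Bool) : List Fml :=
  s.mapIdx fun j c => inputCell M (j + 1) (Sym.ofBool c) false

theorem mem_letterCells {s : List Bool} {φ : Fml} :
    φ ∈ letterCells M s ↔
      ∃ j c, s[j]? = some c ∧ inputCell M (j + 1) (Sym.ofBool c) false = φ := by
  simp [letterCells, List.mem_iff_getElem?]

theorem take_letterCells (n : ℕ) (s : List Bool) :
    (letterCells M s).take n = letterCells M (s.take n) := by
  refine List.ext_getElem? fun i => ?_
  simp only [letterCells, List.getElem?_take, List.getElem?_mapIdx]
  split_ifs <;> rfl

theorem theoryMS_eq_append (s : List Bool) :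
    theoryMS M s =
      defM M ++ blanksAfter M s.length :: inputCell M 0 Sym.start true :: letterCells M s :=
  rfl

theorem length_theoryMS (s : List Bool) :
    (theoryMS M s).length = (defM M).length + (s.length + 2) := by
  simp [theoryMS_eq_append, letterCells]

theorem take_length_theoryMS (r s : List Bool) :
    (theoryMS M s).take (theoryMS M r).length =
      defM M ++ blanksAfter M s.length :: inputCell M 0 Sym.start true ::
        letterCells M (s.take r.length) := by
  rw [length_theoryMS, theoryMS_eq_append, List.take_length_add_append, List.take_succ_cons,
    List.take_succ_cons, take_letterCells]

theorem mem_theoryMS {s : List Bool} {φ : Fml} :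
    φ ∈ theoryMS M s ↔
      φ ∈ defM M ∨ φ = blanksAfter M s.length ∨ φ = inputCell M 0 Sym.start true ∨
        φ ∈ letterCells M s := by
  simp [theoryMS_eq_append]

theorem inputCell_succ_mem_letterCells {s : List Bool} {j : ℕ} {c : Bool} :
    inputCell M (j + 1) (Sym.ofBool c) false ∈ letterCells M s ↔ s[j]? = some c := by
  rw [mem_letterCells]
  refine ⟨?_, fun h => ⟨j, c, h, rfl⟩⟩
  rintro ⟨j', c', h, heq⟩
  obtain rfl : j' = j := Nat.succ_injective (index_eq_of_inputCell_eq heq)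
  rwa [← Sym.ofBool_injective (inputCell_symbol_injective _ _ heq)]

theorem blanksAfter_mem_theoryMS {s : List Bool} {k : ℕ} :
    blanksAfter M k ∈ theoryMS M s ↔ k = s.length := by
  simp [mem_theoryMS, mem_letterCells, blanksAfter_notMem_defM, blanksAfter_ne_inputCell,
    (blanksAfter_ne_inputCell _ _ _ _).symm, blanksAfter_injective.eq_iff]

theorem inputCell_succ_mem_theoryMS {s : List Bool} {j : ℕ} {c : Bool} :
    inputCell M (j + 1) (Sym.ofBool c) false ∈ theoryMS M s ↔ s[j]? = some c := by
  have index_ne_zero : inputCell M (j + 1) (Sym.ofBool c) false ≠ inputCell M 0 Sym.start true :=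
    fun h => Nat.succ_ne_zero j (index_eq_of_inputCell_eq h)
  simp [mem_theoryMS, inputCell_notMem_defM, (blanksAfter_ne_inputCell _ _ _ _).symm,
    index_ne_zero, inputCell_succ_mem_letterCells]

/-- The letter after the first `‖r‖` ones is needed to decide whether `‖s‖ = ‖r‖`. -/
theorem mem_theoryMS_iff_of_take_eq {r s s' : List Bool} {φ : Fml} (hφ : φ ∈ theoryMS M r)
    (h : s.take (r.length + 1) = s'.take (r.length + 1)) :
    φ ∈ theoryMS M s ↔ φ ∈ theoryMS M s' := by
  obtain hdef | rfl | rfl | hletter := mem_theoryMS.1 hφ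
  · simp [mem_theoryMS, hdef]
  · have hlen := congrArg List.length h
    rw [List.length_take, List.length_take] at hlen
    rw [blanksAfter_mem_theoryMS, blanksAfter_mem_theoryMS]
    omega
  · simp [mem_theoryMS]
  · obtain ⟨j, c, hj, rfl⟩ := mem_letterCells.1 hletter
    have hjr : j < r.length + 1 := Nat.lt_succ_of_lt (List.getElem?_eq_some_iff.1 hj).1
    rw [inputCell_succ_mem_theoryMS, inputCell_succ_mem_theoryMS,
      ← List.getElem?_take_of_lt hjr, h, List.getElem?_take_of_lt hjr]

theorem mem_take_length_theoryMS {r s : List Bool} {φ : Fml} (hφ : φ ∈ theoryMS M r) :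
    φ ∈ (theoryMS M s).take (theoryMS M r).length ↔ φ ∈ theoryMS M s := by
  refine ⟨List.mem_of_mem_take, fun hs => ?_⟩
  rw [take_length_theoryMS]
  obtain hdef | hblank | hcell | hletter := mem_theoryMS.1 hs
  · simp [hdef]
  · simp [hblank]
  · simp [hcell]
  · obtain ⟨j, c, hj, rfl⟩ := mem_letterCells.1 hletter
    have hjr : j < r.length := (List.getElem?_eq_some_iff.1 (inputCell_succ_mem_theoryMS.1 hφ)).1
    simp [inputCell_succ_mem_letterCells, List.getElem?_take_of_lt hjr, hj]

end Membership

/-! ### The adjoint checker -/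

section AdjointChecker

variable {S S₀ : RTheory} {π σ : List Fml} {G : List Checker} {i : ℕ}

theorem Checker.run_eq_true_iff {g : Checker} : g.run S σ i = true ↔ g.Cond S σ i := by
  cases g with
  | member => cases h : σ[i]? <;> simp [Checker.run, Checker.Cond, h, S.correct]
  | _ => simp [Checker.run]

theorem CK_eq_true_iff : CK G S σ = true ↔ IsCheckSeq S σ G := by
  by_cases hlen : σ.length = G.length
  · have cond_iff : (∀ (i : ℕ) (hi : i < G.length), G[i].Cond S σ i) ↔
        ∀ (i : ℕ) (g : Checker), G[i]? = some g → g.Cond S σ i := by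
      grind
    simp [CK, IsCheckSeq, hlen, Checker.run_eq_true_iff, cond_iff]
  · simp [CK, IsCheckSeq, hlen, Ne.symm hlen]

theorem Checker.Cond.of_ne_member {g : Checker} (h : g.Cond S₀ π i)
    (hg : g ≠ Checker.member) (S : RTheory) : g.Cond S π i := by
  cases g <;> first | exact absurd rfl hg | exact h

theorem IsCheckSeq.isCheckSeq_iff_forall_mem (hG : IsCheckSeq S₀ π G) :
    IsCheckSeq S π G ↔
      ∀ (i : ℕ) φ, G[i]? = some Checker.member → π[i]? = some φ → φ ∈ S.T := by
  refine ⟨fun h i φ hi hφ => ?_, fun h => ⟨hG.1, fun i g hi => ?_⟩⟩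
  · obtain ⟨ψ, hψ, hmem⟩ := h.2 i _ hi
    rwa [Option.some.inj (hφ.symm.trans hψ)]
  · by_cases hg : g = Checker.member
    · subst hg
      obtain ⟨φ, hφ, -⟩ := hG.2 i _ hi
      exact ⟨φ, hφ, h i φ hi hφ⟩
    · exact (hG.2 i g hi).of_ne_member hg S

end AdjointChecker

theorem CK_theoryAL_take {M : TM} {r : List Bool} {π : List Fml} {G : List Checker}
    (hG : IsCheckSeq (theoryAL M r) π G) (s : List Bool) :
    CK G (theoryAL M (s.take (r.length + 1))) π = CK G (theoryAL M s) π := by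
  have mem_of_member : ∀ (i : ℕ) φ,
      G[i]? = some Checker.member → π[i]? = some φ → φ ∈ theoryMS M r :=
    hG.isCheckSeq_iff_forall_mem.1 hG
  rw [Bool.eq_iff_iff, CK_eq_true_iff, CK_eq_true_iff,
    hG.isCheckSeq_iff_forall_mem, hG.isCheckSeq_iff_forall_mem]
  refine forall₄_congr fun i φ hi hφ => ?_
  exact mem_theoryMS_iff_of_take_eq (mem_of_member i φ hi hφ) (by simp)

theorem Checker.run_member_theoryAL {M : TM} {r : List Bool} {π : List Fml} {i : ℕ} {φ : Fml}
    (h : Checker.member.Cond (theoryAL M r) π i) (hφ : π[i]? = some φ) (s : List Bool) :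
    Checker.member.run (theoryAL M s) π i =
      AL φ ((theoryMS M s).take (theoryMS M r).length) := by
  obtain ⟨ψ, hψ, hmem⟩ := h
  obtain rfl : φ = ψ := Option.some.inj (hφ.symm.trans hψ)
  have run_eq_AL : Checker.member.run (theoryAL M s) π i = AL φ (theoryMS M s) := by
    simp only [Checker.run, hφ, theoryAL]
  rw [run_eq_AL, Bool.eq_iff_iff, AL_correct, AL_correct, mem_take_length_theoryMS hmem]

/-! ### Machines that read a bounded part of the input -/

namespace TM

theorem run_succ (F : TM) (s : List Bool) (i : ℕ) : F.run s (i + 1) = F.step (F.run s i) :=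
  Function.iterate_succ_apply' _ _ _

theorem steps_le {F : TM} {s : List Bool} {i : ℕ} (h : (F.run s i).state = F.qhalt)
    (hs : F.HaltsOn s) : F.steps s hs ≤ i :=
  Nat.find_min' hs h

theorem timeComplexity_le {F : TM} {n K : ℕ} (hF : ∀ s, F.HaltsOn s)
    (h : ∀ s, s.length = n → F.steps s (hF s) ≤ K) : F.timeComplexity hF n ≤ K :=
  Finset.sup_le fun _ _ => h _ List.length_ofFn

theorem init_tape_succ_of_lt (F : TM) {s : List Bool} {j : ℕ} (hj : j < s.length) :
    (F.init s).tape (j + 1) = Sym.ofBool s[j] := by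
  simp [init, List.getElem?_eq_getElem hj]

theorem init_tape_succ_of_ge (F : TM) {s : List Bool} {j : ℕ} (hj : s.length ≤ j) :
    (F.init s).tape (j + 1) = Sym.blank := by
  simp [init, List.getElem?_eq_none hj]

theorem init_tape_succ_ne_start (F : TM) (s : List Bool) (j : ℕ) :
    (F.init s).tape (j + 1) ≠ Sym.start := by
  obtain hj | hj := lt_or_ge j s.length
  · rw [init_tape_succ_of_lt F hj]
    exact Sym.ofBool_ne_start _
  · rw [init_tape_succ_of_ge F hj]
    decide

end TM

/-- The states of a machine that computes a function of the first `m` letters of its input: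
`read l` has read the word `l`, and `back b` returns to the left end with the value `b`. -/
inductive PrefixState (m : ℕ) where
  | halt
  | read (l : {l : List Bool // l.length ≤ m})
  | back (b : Bool)

namespace PrefixState

variable {m : ℕ}

instance : Finite (PrefixState m) := by
  have : Finite {l : List Bool // l.length ≤ m} := List.finite_length_le Bool m
  refine Finite.of_surjective
    (fun x : Option ({l : List Bool // l.length ≤ m} ⊕ Bool) => match x with
      | none => halt
      | some (Sum.inl l) => read l
      | some (Sum.inr b) => back b) ?_
  rintro (_ | l | b)
  exacts [⟨none, rfl⟩, ⟨some (Sum.inl l), rfl⟩, ⟨some (Sum.inr b), rfl⟩]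

/-- The move of `back b` on a square other than the left end. The value `b` is written on every
square on the way, so that it is on square `1` when the left end is reached. -/
def goBack (b : Bool) : PrefixState m × Sym × Move := (back b, Sym.ofBool b, Move.left)

variable (f : List Bool → Bool)

/-- The move of `read l` on the letter `c`. -/
def readLetter (l : {l : List Bool // l.length ≤ m}) (c : Bool) : PrefixState m × Sym × Move :=
  if h : l.1.length < m then
    (read ⟨l.1 ++ [c], by simpa using h⟩, Sym.ofBool c, Move.right)
  else goBack (f l.1)

/-- The transition function of a machine that computes `f` of the first `m` letters. -/
def next : PrefixState m → Sym → PrefixState m × Sym × Move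
  | halt, a => (halt, a, Move.stay)
  | read l, Sym.start => (read l, Sym.start, Move.right)
  | read l, Sym.blank => goBack (f l.1)
  | read l, Sym.zero => readLetter f l false
  | read l, Sym.one => readLetter f l true
  | back _, Sym.start => (halt, Sym.start, Move.right)
  | back b, _ => goBack b

theorem next_start {q : PrefixState m} (hq : q ≠ halt) :
    (next f q Sym.start).2 = (Sym.start, Move.right) := by
  cases q with
  | halt => exact absurd rfl hq
  | read l => rfl
  | back b => rfl

theorem next_read_ofBool (l : {l : List Bool // l.length ≤ m}) (c : Bool) :
    next f (read l) (Sym.ofBool c) = readLetter f l c := by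
  cases c <;> rfl

theorem next_back {a : Sym} (ha : a ≠ Sym.start) (b : Bool) :
    next f (back b : PrefixState m) a = goBack b := by
  cases a <;> first | rfl | exact absurd rfl ha

theorem readLetter_ne_start (l : {l : List Bool // l.length ≤ m}) (c : Bool) :
    (readLetter f l c).2.1 ≠ Sym.start := by
  unfold readLetter
  split_ifs <;> exact Sym.ofBool_ne_start _

theorem next_ne_start (q : PrefixState m) {a : Sym} (ha : a ≠ Sym.start) :
    (next f q a).2.1 ≠ Sym.start := by
  cases q with
  | halt => exact ha
  | back b => rw [next_back f ha]; exact Sym.ofBool_ne_start b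
  | read l =>
    cases a with
    | start => exact absurd rfl ha
    | blank => exact Sym.ofBool_ne_start _
    | zero | one => exact readLetter_ne_start f l _

end PrefixState

open PrefixState

/-- The machine that computes `f` of the first `m` letters of its input, with its states numbered
in an arbitrary way. -/
noncomputable def prefixMachine (m : ℕ) (f : List Bool → Bool) : TM where
  card := Nat.card (PrefixState m)
  δ q a :=
    (Finite.equivFin _ (next f ((Finite.equivFin _).symm q) a).1,
      (next f ((Finite.equivFin _).symm q) a).2)
  q₀ := Finite.equivFin _ (read ⟨[], m.zero_le⟩)
  qhalt := Finite.equivFin _ halt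
  start_right q hq := next_start f fun h => hq (by simp [← h])
  start_only q a ha := next_ne_start f _ ha
  halt_stay a := by simp [next]
  halt_unique q h := by
    by_contra hq
    have right_on_start := next_start f (q := (Finite.equivFin _).symm q)
      fun h' => hq (by simp [← h'])
    have stay_on_start := congrArg Prod.snd (h Sym.start)
    rw [right_on_start, Equiv.symm_apply_apply] at stay_on_start
    cases stay_on_start

namespace prefixMachine

variable {m : ℕ} {f : List Bool → Bool}

/-- The configuration of the prefix machine with state `q`, head at `p` and tape `T`. -/
noncomputable def config (f : List Bool → Bool) (q : PrefixState m) (p : ℕ) (T : ℕ → Sym) :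
    (prefixMachine m f).Config :=
  ⟨Finite.equivFin _ q, p, T⟩

theorem step_config_right {q q' : PrefixState m} {p : ℕ} {T : ℕ → Sym}
    (h : next f q (T p) = (q', T p, Move.right)) :
    (prefixMachine m f).step (config f q p T) = config f q' (p + 1) T := by
  simp [TM.step, config, prefixMachine, h]

theorem step_config_goBack {q : PrefixState m} {p : ℕ} {T : ℕ → Sym} {b : Bool}
    (h : next f q (T (p + 1)) = goBack b) :
    (prefixMachine m f).step (config f q (p + 1) T) =
      config f (back b) p (Function.update T (p + 1) (Sym.ofBool b)) := by
  simp [TM.step, config, prefixMachine, h, goBack]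

theorem run_read (s : List Bool) {k : ℕ} (hkm : k ≤ m) (hks : k ≤ s.length) :
    (prefixMachine m f).run s (k + 1) =
      config f (read ⟨s.take k, by simp [hkm]⟩) (k + 1) ((prefixMachine m f).init s).tape := by
  induction k with
  | zero => exact step_config_right (q := read ⟨[], m.zero_le⟩) (p := 0) rfl
  | succ k ih =>
    rw [TM.run_succ, ih (by omega) (by omega)]
    refine step_config_right ?_
    rw [TM.init_tape_succ_of_lt _ hks, next_read_ofBool, readLetter, dif_pos (by simp; omega)]
    simp [List.take_append_getElem]

theorem next_read_eq_goBack (s : List Bool) :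
    next f (read ⟨s.take m, List.length_take_le m s⟩)
      (((prefixMachine m f).init s).tape (min m s.length + 1)) = goBack (f (s.take m)) := by
  obtain h | h := le_or_gt s.length m
  · rw [min_eq_right h, TM.init_tape_succ_of_ge _ le_rfl]
    rfl
  · rw [min_eq_left h.le, TM.init_tape_succ_of_lt _ h, next_read_ofBool, readLetter,
      dif_neg (by simp [h.le])]

theorem run_turn (s : List Bool) :
    (prefixMachine m f).run s (min m s.length + 2) =
      config f (back (f (s.take m))) (min m s.length)
        (Function.update ((prefixMachine m f).init s).tape (min m s.length + 1)
          (Sym.ofBool (f (s.take m)))) := by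
  rw [TM.run_succ, run_read s (min_le_left _ _) (min_le_right _ _)]
  refine step_config_goBack ?_
  simpa only [← List.take_eq_take_min] using next_read_eq_goBack s

theorem iterate_step_back {b : Bool} {p : ℕ} {T : ℕ → Sym} (hzero : T 0 = Sym.start)
    (hsucc : ∀ j, T (j + 1) ≠ Sym.start) (hnext : T (p + 1) = Sym.ofBool b) :
    ∃ T', (prefixMachine m f).step^[p + 1] (config f (back b) p T) = config f halt 1 T' ∧
      T' 1 = Sym.ofBool b := by
  induction p generalizing T with
  | zero => exact ⟨T, step_config_right (p := 0) (by rw [hzero]; rfl), hnext⟩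
  | succ p ih =>
    rw [Function.iterate_succ_apply, step_config_goBack (next_back f (hsucc p) b)]
    refine ih (by simp [hzero]) (fun j => ?_) (by simp)
    by_cases hj : j = p
    · simp [hj, Sym.ofBool_ne_start]
    · simp [hj, hsucc]

theorem exists_run_eq_halt (s : List Bool) :
    ∃ i ≤ 2 * m + 3, ∃ T, (prefixMachine m f).run s i = config f halt 1 T ∧
      T 1 = Sym.ofBool (f (s.take m)) := by
  have back_to_start := iterate_step_back (m := m) (f := f) (b := f (s.take m))
    (p := min m s.length) (T := Function.update ((prefixMachine m f).init s).tape
      (min m s.length + 1) (Sym.ofBool (f (s.take m)))) rfl (fun j => ?_) (by simp)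
  · rw [← run_turn, TM.run, ← Function.iterate_add_apply] at back_to_start
    exact ⟨_, by omega, back_to_start⟩
  · by_cases hj : j = min m s.length
    · simp [hj, Sym.ofBool_ne_start]
    · simp [hj, TM.init_tape_succ_ne_start]

end prefixMachine

theorem TM.exists_outputs_timeComplexity_le {m : ℕ} {f : List Bool → Bool}
    (hf : ∀ s, f (s.take m) = f s) :
    ∃ (F : TM) (hF : ∀ s, F.HaltsOn s), (∀ s, F.Outputs s (f s)) ∧
      ∀ n, F.timeComplexity hF n ≤ 2 * m + 3 := by
  choose i hi T hrun hT using prefixMachine.exists_run_eq_halt (m := m) (f := f)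
  have state_eq : ∀ s, ((prefixMachine m f).run s (i s)).state = (prefixMachine m f).qhalt :=
    fun s => by rw [hrun]; rfl
  refine ⟨prefixMachine m f, fun s => ⟨i s, state_eq s⟩, fun s => ⟨i s, state_eq s, ?_⟩, fun n =>
    timeComplexity_le _ fun s _ => (steps_le (state_eq s) _).trans (hi s)⟩
  rw [hrun, ← hf s]
  exact ⟨rfl, hT s⟩

end NormalProof

open NormalProof in
theorem mainTheorem5_general {M : TM} {r : List Bool} {π : List Fml} {G : List Checker}
    (hG : IsCheckSeq (theoryAL M r) π G) :
    (∃ (F : TM) (hF : ∀ s, F.HaltsOn s), (∀ s, F.Outputs s (CK G (theoryAL M s) π)) ∧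
      ∃ K : ℕ, ∀ s : List Bool, F.timeComplexity hF s.length < K) ∧
    (∀ i g, G[i]? = some g → g ≠ Checker.member → ∀ s, g.run (theoryAL M s) π i = true) ∧
    (∀ i φ, G[i]? = some Checker.member → π[i]? = some φ →
      ∀ s, Checker.member.run (theoryAL M s) π i =
        AL φ ((theoryMS M s).take (theoryMS M r).length)) := by
  refine ⟨?_, fun i g hi hg s => ?_, fun i φ hi hφ s => ?_⟩
  · obtain ⟨F, hF, outputs, time_le⟩ := TM.exists_outputs_timeComplexity_le
      (f := fun s => CK G (theoryAL M s) π) (CK_theoryAL_take hG)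
    exact ⟨F, hF, outputs, _, fun s => Nat.lt_succ_of_le (time_le s.length)⟩
  · exact Checker.run_eq_true_iff.2 ((hG.2 i g hi).of_ne_member hg _)
  · exact Checker.run_member_theoryAL (hG.2 i _ hi) hφ s

theorem mainTheorem5
    (M : NormalProof.TM) (b : Bool) (r : List Bool) (hM : M.Outputs r b)
    (π : List NormalProof.Fml) (hπ : NormalProof.IsNormalProof M r b π)
    (G : List NormalProof.Checker)
    (hG : NormalProof.IsCheckSeq (NormalProof.theoryAL M r) π G) :
    -- a Turing machine computes `s ↦ CK_π(⟨T_{M,s}, AL⟩, π)` in bounded time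
    (∃ (F : NormalProof.TM) (hF : ∀ s, F.HaltsOn s),
      (∀ s, F.Outputs s (NormalProof.CK G (NormalProof.theoryAL M s) π)) ∧
      ∃ K : ℕ, ∀ s : List Bool, F.timeComplexity hF s.length < K) ∧
    -- the checkers that are not of type `G_IN` return `1` whatever `s` is
    (∀ i g, G[i]? = some g → g ≠ NormalProof.Checker.member →
      ∀ s, g.run (NormalProof.theoryAL M s) π i = true) ∧
    -- a checker of type `G_IN` needs no more than the first `|T_{M,r}|` members of `T_{M,s}`
    (∀ i φ, G[i]? = some NormalProof.Checker.member → π[i]? = some φ →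
      ∀ s, NormalProof.Checker.member.run (NormalProof.theoryAL M s) π i =
        NormalProof.AL φ
          ((NormalProof.theoryMS M s).take (NormalProof.theoryMS M r).length)) :=
  mainTheorem5_general hG
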